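/- Throughout, a \emph{semiflow} $(T,X)$ consists of a topological semigroup $T$ with neutral element $e$ (multiplication jointly continuous), a non-empty compact Hausdorff space $X$ with its unique compatible uniformity $\mathscr{U}_X$, and a jointly continuous map $T\times X\to X$, $(t,x)\mapsto tx$, with $ex=x$ and $(ts)x=t(sx)$ for all $s,t\in T$, $x\in X$. The semiflow $(T,X)$ is \emph{minimal} if $Tx=\{tx : t\in T\}$ is dense in $X$ for every $x\in X$. It is \emph{weakly almost periodic} if for every $f\in C(X,\mathbb{R})$ the set $\{f_t : t\in T\}$, where $f_t(x)=f(tx)$, is relatively compact in $C(X,\mathbb{R})$ for the topology of pointwise convergence on $X$. A set $A\subseteq T$ is \emph{syndetic} if there is a compact $K\subseteq T$ with $Kt\cap A\neq\emptyset$ for every $t\in T$, and $(T,X)$ is \emph{uniformly almost periodic} if for every $\varepsilon\in\mathscr{U}_X$ there is a syndetic set $A\subseteq T$ such that $(x,ax)\in\varepsilon$ for all $a\in A$ and all $x\in X$. The semigroup $T$ is \emph{amenable} if for every semiflow $(T,Y)$ there is a Borel probability measure $\mu$ on $Y$ with $\mu(B)=\mu(t^{-1}B)$ for all $t\in T$ and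 all Borel $B\subseteq Y$, where $t^{-1}B=\{y\in Y : ty\in B\}$. \textbf{Theorem.} Let $(T,X)$ be a minimal weakly almost periodic semiflow such that $T$ is amenable and, for each $t\in T$, the map $x\mapsto tx$ is a bijection of $X$ onto itself. Then $(T,X)$ is uniformly almost periodic. -/

import Mathlib

open MeasureTheory
open scoped Uniformity Topology

universe u v

/-! A semiflow `(T, X)` is encoded by a monoid `T` with a topology and `[ContinuousMul T]`
(a topological semigroup with neutral element), a compact Hausdorff space `X`, an action
`[MulAction T X]` (so `1 • x = x` and `(t * s) • x = t • (s • x)`) and `[ContinuousSMul T X]`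
(joint continuity of `(t, x) ↦ t • x`). -/

namespace Semiflow

/-- A subset `A` of a topological semigroup `T` is syndetic if there is a compact `K ⊆ T` such that
`K t ∩ A` is non-empty for every `t`. -/
def IsSyndetic {T : Type u} [Mul T] [TopologicalSpace T] (A : Set T) : Prop :=
  ∃ K : Set T, IsCompact K ∧ ∀ t : T, ((fun k : T => k * t) '' K ∩ A).Nonempty

/-- `(T, X)` is uniformly almost periodic: for every entourage `ε` there is a syndetic `A ⊆ T` with
`A x ⊆ ε[x]` for all `x`. -/
def IsUniformlyAlmostPeriodic (T : Type u) (X : Type v) [Monoid T] [TopologicalSpace T]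
    [UniformSpace X] [MulAction T X] : Prop :=
  ∀ ε ∈ 𝓤 X, ∃ A : Set T, IsSyndetic A ∧ ∀ x : X, ∀ a ∈ A, (x, a • x) ∈ ε

/-- The topology of pointwise convergence on `C(X, ℝ)`. -/
abbrev pointwiseTopology (X : Type v) [TopologicalSpace X] : TopologicalSpace C(X, ℝ) :=
  TopologicalSpace.induced (fun f : C(X, ℝ) => (f : X → ℝ)) Pi.topologicalSpace

/-- The family `T f = {f_t | t ∈ T}` in `C(X, ℝ)`, where `f_t x = f (t • x)`. -/
def translates (T : Type u) {X : Type v} [Monoid T] [TopologicalSpace X] [MulAction T X]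
    (f : C(X, ℝ)) : Set C(X, ℝ) :=
  {g | ∃ t : T, ∀ x : X, g x = f (t • x)}

/-- `(T, X)` is weakly almost periodic: for every `f ∈ C(X, ℝ)`, the family `T f` is relatively
compact in `C(X, ℝ)` for the topology of pointwise convergence. -/
def IsWeaklyAlmostPeriodic (T : Type u) (X : Type v) [Monoid T] [TopologicalSpace X]
    [MulAction T X] : Prop :=
  ∀ f : C(X, ℝ),
    @IsCompact C(X, ℝ) (pointwiseTopology X)
      (@closure C(X, ℝ) (pointwiseTopology X) (translates T f))

/-- The topological semigroup `T` is amenable: every semiflow `(T, Y)` on a non-empty compact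
Hausdorff space `Y` admits an invariant Borel probability measure.

It suffices to let `Y` range over the universe of `T`: every non-empty semiflow contains an orbit
closure, and the points of an orbit closure inject into the filters on `T`. -/
def IsAmenable (T : Type u) [Monoid T] [TopologicalSpace T] : Prop :=
  ∀ (Y : Type u) [TopologicalSpace Y] [CompactSpace Y] [T2Space Y] [Nonempty Y]
    [MeasurableSpace Y] [BorelSpace Y] [MulAction T Y] [ContinuousSMul T Y],
    ∃ μ : Measure Y, IsProbabilityMeasure μ ∧
      ∀ (t : T) (B : Set Y), MeasurableSet B → μ B = μ ((fun y : Y => t • y) ⁻¹' B)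

end Semiflow

open Filter Set

namespace Semiflow

/-! ### Pointwise compact sets of continuous functions -/

/-! Let `E` be the pointwise closure of the translations in `X → X`. Weak almost periodicity makes
every `p ∈ E` continuous (`IsWeaklyAlmostPeriodic.continuous`). Amenability gives an invariant
probability measure `μ`, of full support by minimality. Integrals of continuous functions depend
continuously on `p ∈ E`, so every `p ∈ E` preserves `μ`; hence `p` is onto, and an idempotent
argument gives it a left inverse in `E`.

If `p → id` in `E`, then `f ∘ p → f` weakly, and in `L²(μ)` because norms are preserved. Since `E`
acts transitively on `X` by measure-preserving maps, this upgrades to uniform convergence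
(`IsWeaklyAlmostPeriodic.eventually_forall_mem`). Left inverses and compactness of `E` then yield
syndeticity. -/

/-- A point of the closure of a subset of a pointwise compact set of continuous functions is
the pointwise limit of a sequence. -/
theorem exists_seq_tendsto_of_mem_closure {X : Type v} [TopologicalSpace X] [CompactSpace X]
    {K A : Set (X → ℝ)} (hK : IsCompact K) (hc : ∀ k ∈ K, Continuous k) (hA : A ⊆ K)
    {g : X → ℝ} (hg : g ∈ closure A) :
    ∃ a : ℕ → X → ℝ, (∀ n, a n ∈ A) ∧ Tendsto a atTop (𝓝 g) := by
  classical
  have hgK : g ∈ K := closure_minimal hA hK.isClosed hg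
  have net : ∀ (G : Finset (X → ℝ)) (n : ℕ), (∀ h ∈ G, Continuous h) →
      ∃ F : Finset X, ∀ x, ∃ y ∈ F, ∀ h ∈ G, |h x - h y| < 1 / ((n : ℝ) + 1) := by
    intro G n hG
    have hn : (0 : ℝ) < 1 / ((n : ℝ) + 1) := by positivity
    obtain ⟨F, -, hF⟩ := isCompact_univ.elim_nhds_subcover
      (fun y : X => {x | ∀ h ∈ G, |h x - h y| < 1 / ((n : ℝ) + 1)}) (fun y _ => by
        have : ∀ h ∈ G, ∀ᶠ x in 𝓝 y, |h x - h y| < 1 / ((n : ℝ) + 1) := fun h hh =>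
          (Metric.tendsto_nhds.1 ((hG h hh).tendsto y)) _ hn
        exact (Filter.eventually_all_finset G).2 this)
    refine ⟨F, fun x => ?_⟩
    obtain ⟨y, hy, hxy⟩ := mem_iUnion₂.1 (hF (mem_univ x))
    exact ⟨y, hy, hxy⟩
  -- A state `(a, G, F, n)` holds the new function, all functions so far, a finite net of points for
  -- `g` and `G`, and the precision `n`. Each later function is close to `g` on all earlier nets.
  obtain ⟨σ, hP, hr⟩ := exists_seq_of_forall_finset_exists
    (α := (X → ℝ) × Finset (X → ℝ) × Finset X × ℕ)
    (fun s => s.1 ∈ A ∧ s.1 ∈ s.2.1 ∧ (∀ h ∈ s.2.1, h ∈ K) ∧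
      ∀ x, ∃ y ∈ s.2.2.1, ∀ h ∈ insert g s.2.1, |h x - h y| < 1 / ((s.2.2.2 : ℝ) + 1))
    (fun s s' => s.2.1 ⊆ s'.2.1 ∧ s.2.2.2 < s'.2.2.2 ∧
      ∀ y ∈ s.2.2.1, |s'.1 y - g y| < 1 / ((s'.2.2.2 : ℝ) + 1))
    (by
      intro S hS
      let n := S.sup (fun s => s.2.2.2) + 1
      let F₀ := S.biUnion (fun s => s.2.2.1)
      have hn : (0 : ℝ) < 1 / ((n : ℝ) + 1) := by positivity
      have hU : {k : X → ℝ | ∀ y ∈ F₀, |k y - g y| < 1 / ((n : ℝ) + 1)} ∈ 𝓝 g := by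
        have : ∀ y ∈ F₀, ∀ᶠ k : X → ℝ in 𝓝 g, |k y - g y| < 1 / ((n : ℝ) + 1) := fun y _ =>
          (Metric.tendsto_nhds.1 ((continuous_apply y).tendsto g)) _ hn
        exact (Filter.eventually_all_finset F₀).2 this
      obtain ⟨a, haU, haA⟩ := mem_closure_iff_nhds.1 hg _ hU
      let G := insert a (S.biUnion (fun s => s.2.1))
      have hGK : ∀ h ∈ G, h ∈ K := by
        intro h hh
        rcases Finset.mem_insert.1 hh with rfl | hh
        · exact hA haA
        · obtain ⟨s, hs, hhs⟩ := Finset.mem_biUnion.1 hh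
          exact (hS s hs).2.2.1 h hhs
      obtain ⟨F, hF⟩ := net (insert g G) n (fun h hh => by
        rcases Finset.mem_insert.1 hh with rfl | hh
        · exact hc _ hgK
        · exact hc _ (hGK h hh))
      refine ⟨(a, G, F, n), ⟨haA, Finset.mem_insert_self _ _, hGK, hF⟩, fun s hs => ⟨?_, ?_, ?_⟩⟩
      · exact (Finset.subset_biUnion_of_mem (fun s : (X → ℝ) × Finset (X → ℝ) × Finset X × ℕ =>
          s.2.1) hs).trans (Finset.subset_insert _ _)
      · exact Nat.lt_succ_of_le (Finset.le_sup (f := fun s : (X → ℝ) × Finset (X → ℝ) ×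
          Finset X × ℕ => s.2.2.2) hs)
      · exact fun y hy => haU y (Finset.mem_biUnion.2 ⟨s, hs, hy⟩))
  have hmono : StrictMono fun n => (σ n).2.2.2 := fun m n h => (hr m n h).2.1
  have hlim : Tendsto (fun n => 1 / (((σ n).2.2.2 : ℝ) + 1)) atTop (𝓝 0) :=
    tendsto_one_div_add_atTop_nhds_zero_nat.comp hmono.tendsto_atTop
  refine ⟨fun n => (σ n).1, fun n => (hP n).1, tendsto_iff_ultrafilter _ _ _ |>.2 fun U hU => ?_⟩
  have hmem : ∀ n, (σ n).1 ∈ K := fun n => hA (hP n).1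
  obtain ⟨h, hhK, hh⟩ := hK.ultrafilter_le_nhds (U.map fun n => (σ n).1)
    (le_principal_iff.2 (Eventually.of_forall hmem : ∀ᶠ n in (U : Filter ℕ), (σ n).1 ∈ K))
  have hh' : ∀ x, Tendsto (fun n => (σ n).1 x) U (𝓝 (h x)) := fun x =>
    ((continuous_apply x).tendsto h).comp hh
  have hlimU := hlim.mono_left hU
  have heqF : ∀ n, ∀ y ∈ (σ n).2.2.1, h y = g y := by
    intro n y hy
    have h0 : Tendsto (fun m => (σ m).1 y - g y) U (𝓝 0) :=
      squeeze_zero_norm' ((eventually_gt_atTop n).filter_mono hU |>.mono fun m hm =>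
        ((hr n m hm).2.2 y hy).le) hlimU
    exact sub_eq_zero.1 (tendsto_nhds_unique ((hh' y).sub_const (g y)) h0)
  have hhg : h = g := by
    ext x
    -- Net points `y n` shadow `x` and converge to `z` along `U`. No `σ j` separates `x` from `z`,
    -- nor does `g`; `h = g` on the nets gives `h z = g z` by continuity.
    choose y hyF hy using fun n => (hP n).2.2.2 x
    obtain ⟨z, -, hz⟩ := isCompact_univ.ultrafilter_le_nhds (U.map y) (by simp)
    have hz' : Tendsto y U (𝓝 z) := hz
    have key : ∀ k : X → ℝ, Continuous k →
        (∀ᶠ n in (U : Filter ℕ), k ∈ insert g (σ n).2.1) → k x = k z := by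
      intro k hk hkU
      have h0 : Tendsto (fun n => k x - k (y n)) U (𝓝 0) :=
        squeeze_zero_norm' (hkU.mono fun n hn => (hy n k hn).le) hlimU
      exact sub_eq_zero.1 (tendsto_nhds_unique (((hk.tendsto z).comp hz').const_sub (k x)) h0)
    have hgz : g x = g z := key g (hc g hgK) (Eventually.of_forall fun n =>
      Finset.mem_insert_self _ _)
    have haz : ∀ j, (σ j).1 x = (σ j).1 z := fun j =>
      key _ (hc _ (hmem j)) ((eventually_gt_atTop j).filter_mono hU |>.mono fun n hn =>
        Finset.mem_insert_of_mem ((hr j n hn).1 (hP j).2.1))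
    have hhz : h x = h z := tendsto_nhds_unique (hh' x) (by simpa only [haz] using hh' z)
    have hz2 : h z = g z := by
      refine tendsto_nhds_unique (((hc h hhK).tendsto z).comp hz') ?_
      refine Tendsto.congr (fun n => (heqF n _ (hyF n)).symm) (((hc g hgK).tendsto z).comp hz')
    rw [hhz, hz2, hgz]
  exact hhg ▸ hh

/-- On a uniformly bounded pointwise compact set of continuous functions, integration against a
continuous weight is continuous for pointwise convergence. -/
theorem continuousOn_integral_mul {X : Type v} [TopologicalSpace X] [CompactSpace X]
    [MeasurableSpace X] [BorelSpace X] (μ : Measure X) [IsFiniteMeasure μ]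
    {K : Set (X → ℝ)} (hK : IsCompact K) (hc : ∀ k ∈ K, Continuous k)
    {M : ℝ} (hM : ∀ k ∈ K, ∀ x, |k x| ≤ M) {w : X → ℝ} (hw : Continuous w) :
    ContinuousOn (fun k : X → ℝ => ∫ x, k x * w x ∂μ) K := by
  intro g hg
  by_contra hcon
  rw [ContinuousWithinAt, Metric.tendsto_nhds] at hcon
  push Not at hcon
  obtain ⟨ε, hε, hfr⟩ := hcon
  set Φ : (X → ℝ) → ℝ := fun k => ∫ x, k x * w x ∂μ with hΦ
  have hgcl : g ∈ closure {k ∈ K | ε ≤ dist (Φ k) (Φ g)} := by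
    rw [mem_closure_iff_frequently]
    have := frequently_nhdsWithin_iff.1 hfr
    exact this.mono fun k hk => ⟨hk.2, by simpa using hk.1⟩
  obtain ⟨a, haA, ha⟩ := exists_seq_tendsto_of_mem_closure hK hc (fun k hk => hk.1) hgcl
  obtain ⟨W, hW⟩ := isCompact_univ.exists_bound_of_continuousOn hw.continuousOn
  have hlim : Tendsto (fun n => Φ (a n)) atTop (𝓝 (Φ g)) := by
    refine tendsto_integral_of_dominated_convergence (fun _ => M * W)
      (fun n => ((hc _ (haA n).1).mul hw).measurable.aestronglyMeasurable) ?_ ?_ ?_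
    · exact integrable_const _
    · refine fun n => Eventually.of_forall fun x => ?_
      rw [norm_mul]
      exact mul_le_mul (hM _ (haA n).1 x) (hW x (mem_univ x)) (norm_nonneg _)
        ((abs_nonneg _).trans (hM _ (haA n).1 x))
    · exact Eventually.of_forall fun x =>
        (((continuous_apply x).tendsto g).comp ha).mul_const _
  obtain ⟨n, hn⟩ := (Metric.tendsto_nhds.1 hlim ε hε).exists
  exact absurd (haA n).2 (not_le.2 hn)

/-! ### Invariant measures -/

/-- Amenability is tested only on spaces in the universe of `T`. The trace on `T` of the
neighbourhood filter of a point determines that point, since orbits are dense. -/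
theorem small_of_isMinimal {T : Type u} {X : Type v} [Monoid T] [TopologicalSpace X] [T2Space X]
    [MulAction T X] [MulAction.IsMinimal T X] [Nonempty X] : Small.{u} X := by
  obtain ⟨x₀⟩ := ‹Nonempty X›
  have hd : Dense (range fun t : T => t • x₀) := MulAction.dense_orbit T x₀
  refine small_of_injective (β := Filter T) (f := fun x => comap (fun t : T => t • x₀) (𝓝 x)) ?_
  intro x y hxy
  have hne : (comap (fun t : T => t • x₀) (𝓝 x)).NeBot := by
    rw [comap_neBot_iff_frequently]
    exact mem_closure_iff_frequently.1 (hd x)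
  have hx : Tendsto (fun t : T => t • x₀) (comap (fun t : T => t • x₀) (𝓝 x)) (𝓝 x) :=
    tendsto_comap
  have hy : Tendsto (fun t : T => t • x₀) (comap (fun t : T => t • x₀) (𝓝 x)) (𝓝 y) := by
    have : comap (fun t : T => t • x₀) (𝓝 x) = comap (fun t : T => t • x₀) (𝓝 y) := hxy
    rw [this]
    exact tendsto_comap
  exact tendsto_nhds_unique hx hy

theorem IsAmenable.exists_invariant_measure {T : Type u} {X : Type v} [Monoid T]
    [TopologicalSpace T] [TopologicalSpace X] [CompactSpace X] [T2Space X] [Nonempty X]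
    [MeasurableSpace X] [BorelSpace X] [MulAction T X] [ContinuousSMul T X] [Small.{u} X]
    (ham : IsAmenable T) :
    ∃ μ : Measure X, IsProbabilityMeasure μ ∧
      ∀ (t : T) (f : X → ℝ), Continuous f → ∫ x, f (t • x) ∂μ = ∫ x, f x ∂μ := by
  let e : Shrink.{u} X ≃ X := (equivShrink X).symm
  let : TopologicalSpace (Shrink.{u} X) := TopologicalSpace.induced e inferInstance
  let h : Shrink.{u} X ≃ₜ X := e.toHomeomorphOfIsInducing ⟨rfl⟩
  have : CompactSpace (Shrink.{u} X) := h.symm.compactSpace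
  have : T2Space (Shrink.{u} X) := h.symm.t2Space
  have : Nonempty (Shrink.{u} X) := e.nonempty
  let : MeasurableSpace (Shrink.{u} X) := borel _
  have : BorelSpace (Shrink.{u} X) := ⟨rfl⟩
  let : MulAction T (Shrink.{u} X) := e.mulAction T
  have hsmul : ∀ (t : T) (y : Shrink.{u} X), h (t • y) = t • h y := fun t y =>
    e.apply_symm_apply _
  have : ContinuousSMul T (Shrink.{u} X) := ⟨by
    refine continuous_induced_rng.2 ?_
    have hc : Continuous fun z : T × Shrink.{u} X => z.1 • h z.2 :=
      continuous_fst.smul (h.continuous.comp continuous_snd)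
    exact hc.congr fun z => (hsmul z.1 z.2).symm⟩
  obtain ⟨ν, hν, hinv⟩ := ham (Shrink.{u} X)
  refine ⟨ν.map h, Measure.isProbabilityMeasure_map h.continuous.measurable.aemeasurable,
    fun t f hf => ?_⟩
  have ht : Continuous fun y : Shrink.{u} X => t • y := continuous_const_smul t
  have hmap : ν.map (fun y => t • y) = ν := by
    ext B hB
    rw [Measure.map_apply ht.measurable hB, ← hinv t B hB]
  have hme : MeasurableEmbedding h := Homeomorph.measurableEmbedding h
  rw [hme.integral_map, hme.integral_map]
  have := integral_map (μ := ν) ht.measurable.aemeasurable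
    (f := fun y => f (h y)) (hf.comp h.continuous).measurable.aestronglyMeasurable
  rw [hmap] at this
  simpa only [hsmul] using this.symm

theorem _root_.Continuous.integrable_of_compactSpace {X : Type v} [TopologicalSpace X]
    [CompactSpace X] [MeasurableSpace X] [BorelSpace X] (μ : Measure X) [IsFiniteMeasure μ]
    {f : X → ℝ} (hf : Continuous f) : Integrable f μ := by
  obtain ⟨M, hM⟩ := isCompact_univ.exists_bound_of_continuousOn hf.continuousOn
  exact Integrable.of_bound hf.measurable.aestronglyMeasurable M
    (Eventually.of_forall fun x => hM x (mem_univ x))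

/-- An invariant probability measure on a minimal compact semiflow is strictly positive on
non-negative continuous functions. -/
theorem eq_zero_of_integral_nonpos {T : Type u} {X : Type v} [Monoid T]
    [TopologicalSpace X] [CompactSpace X] [MeasurableSpace X] [BorelSpace X] [MulAction T X]
    [ContinuousConstSMul T X] [MulAction.IsMinimal T X] {μ : Measure X} [IsProbabilityMeasure μ]
    (hinv : ∀ (t : T) (f : X → ℝ), Continuous f → ∫ x, f (t • x) ∂μ = ∫ x, f x ∂μ)
    {f : X → ℝ} (hf : Continuous f) (h0 : ∀ x, 0 ≤ f x) (hI : ∫ x, f x ∂μ ≤ 0) (x : X) :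
    f x = 0 := by
  by_contra hx
  have hpos : 0 < f x := lt_of_le_of_ne (h0 x) (Ne.symm hx)
  set c := f x / 2 with hc
  have hU : IsOpen {y | c < f y} := isOpen_lt continuous_const hf
  -- By minimality, finitely many preimages of `{c < f}` cover `X`, so a finite sum of translates of
  -- `f` is at least `c > 0` but has integral at most `0`.
  obtain ⟨F, hF⟩ := isCompact_univ.elim_finite_subcover
    (fun t : T => {y : X | c < f (t • y)}) (fun t => hU.preimage (continuous_const_smul t))
    (fun y _ => by
      obtain ⟨t, ht⟩ := hU.exists_smul_mem T y ⟨x, show c < f x by linarith⟩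
      exact mem_iUnion.2 ⟨t, ht⟩)
  have hcont : ∀ t : T, Continuous fun y => f (t • y) := fun t => hf.comp (continuous_const_smul t)
  have hsum : ∫ y, ∑ t ∈ F, f (t • y) ∂μ ≤ 0 := by
    rw [integral_finsetSum _ fun t _ => (hcont t).integrable_of_compactSpace μ]
    exact Finset.sum_nonpos fun t _ => (hinv t f hf).trans_le hI
  have hlow : c ≤ ∫ y, ∑ t ∈ F, f (t • y) ∂μ := by
    have h1 : ∫ _ : X, c ∂μ ≤ ∫ y, ∑ t ∈ F, f (t • y) ∂μ := by
      refine integral_mono (integrable_const c)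
        (integrable_finsetSum _ fun t _ => (hcont t).integrable_of_compactSpace μ) fun y => ?_
      obtain ⟨t, htF, ht⟩ := mem_iUnion₂.1 (hF (mem_univ y))
      have ht' : c < f (t • y) := ht
      exact ht'.le.trans (Finset.single_le_sum (f := fun t : T => f (t • y))
        (fun s _ => h0 _) htF)
    simpa using h1
  linarith

/-! ### The enveloping semigroup -/

/-- The enveloping semigroup: the pointwise closure of the translations. -/
def enveloping (T : Type u) (X : Type v) [Monoid T] [TopologicalSpace X] [MulAction T X] :
    Set (X → X) :=
  closure (range fun (t : T) (x : X) => t • x)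

section Enveloping

variable {T : Type u} {X : Type v} [Monoid T] [TopologicalSpace X] [MulAction T X]

theorem smul_mem_enveloping (t : T) : (fun x : X => t • x) ∈ enveloping T X :=
  subset_closure (mem_range_self t)

/-- Composition is always continuous in the left factor, but in the right one only when the left is
continuous, as translations are; hence two closure steps. -/
theorem comp_mem_enveloping [ContinuousConstSMul T X] {p q : X → X} (hp : p ∈ enveloping T X)
    (hq : q ∈ enveloping T X) : p ∘ q ∈ enveloping T X := by
  have hleft : ∀ t : T, (fun x : X => t • x) ∘ q ∈ enveloping T X := by
    intro t
    refine map_mem_closure (f := fun r : X → X => (fun x : X => t • x) ∘ r)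
      (continuous_pi fun x => (continuous_const_smul t).comp (continuous_apply x)) hq ?_
    rintro _ ⟨s, rfl⟩
    exact ⟨t * s, funext fun x => mul_smul t s x⟩
  have : MapsTo (fun r : X → X => r ∘ q) (closure (range fun (t : T) (x : X) => t • x))
      (enveloping T X) :=
    (mapsTo_range_iff.2 hleft : MapsTo (fun r : X → X => r ∘ q) _ _).closure_left
      (continuous_pi fun x => continuous_apply (q x)) isClosed_closure
  exact this hp

/-- `f ∘ p` is a pointwise limit of translates of `f`, and relative compactness keeps such limits
inside `C(X, ℝ)`. -/
theorem IsWeaklyAlmostPeriodic.continuous_comp (hwap : IsWeaklyAlmostPeriodic T X)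
    [ContinuousConstSMul T X] {p : X → X} (hp : p ∈ enveloping T X) {f : X → ℝ}
    (hf : Continuous f) : Continuous (f ∘ p) := by
  let := pointwiseTopology X
  have hcoe : Continuous (fun g : C(X, ℝ) => (g : X → ℝ)) := continuous_induced_dom
  have hK := (hwap ⟨f, hf⟩).image hcoe
  have hsub : enveloping T X ⊆ (fun q : X → X => f ∘ q) ⁻¹'
      ((fun g : C(X, ℝ) => (g : X → ℝ)) '' closure (translates T ⟨f, hf⟩)) := by
    refine closure_minimal ?_ (hK.isClosed.preimage ?_)
    · rintro _ ⟨t, rfl⟩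
      exact ⟨⟨fun x => f (t • x), hf.comp (continuous_const_smul t)⟩,
        subset_closure ⟨t, fun x => rfl⟩, rfl⟩
    · exact continuous_pi fun x => hf.comp (continuous_apply x)
  obtain ⟨g, -, hg⟩ := hsub hp
  have hg' : (g : X → ℝ) = f ∘ p := hg
  exact hg' ▸ g.continuous

theorem _root_.continuous_of_forall_comp_real {Y Z : Type*} [TopologicalSpace Y]
    [TopologicalSpace Z] [CompletelyRegularSpace Z] {p : Y → Z}
    (h : ∀ f : Z → ℝ, Continuous f → Continuous (f ∘ p)) : Continuous p := by
  rw [continuous_iff_continuousAt]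
  intro x U hU
  obtain ⟨V, hVU, hV, hxV⟩ := mem_nhds_iff.1 hU
  obtain ⟨f, hf, hf0, hf1⟩ := CompletelyRegularSpace.completely_regular (p x) Vᶜ hV.isClosed_compl
    (by simpa using hxV)
  have hc := h (fun z => (f z : ℝ)) (continuous_subtype_val.comp hf)
  have : ∀ᶠ y in 𝓝 x, (f (p y) : ℝ) < 1 :=
    hc.continuousAt.eventually (gt_mem_nhds (by simp [hf0]))
  refine mem_map.2 (mem_of_superset this fun y hy => ?_)
  by_contra hyU
  have := hf1 (show p y ∈ Vᶜ from fun hV' => hyU (hVU hV'))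
  simp [this] at hy

variable [CompactSpace X]

theorem isCompact_enveloping : IsCompact (enveloping T X) := isClosed_closure.isCompact

variable [T2Space X]

theorem IsWeaklyAlmostPeriodic.continuous (hwap : IsWeaklyAlmostPeriodic T X)
    [ContinuousConstSMul T X] {p : X → X} (hp : p ∈ enveloping T X) : Continuous p :=
  continuous_of_forall_comp_real fun _ hf => hwap.continuous_comp hp hf

variable [MeasurableSpace X] [BorelSpace X] {μ : Measure X} [IsProbabilityMeasure μ]

theorem IsWeaklyAlmostPeriodic.continuousOn_integral_comp_mul [ContinuousConstSMul T X]
    (hwap : IsWeaklyAlmostPeriodic T X) {f w : X → ℝ} (hf : Continuous f) (hw : Continuous w) :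
    ContinuousOn (fun p : X → X => ∫ x, f (p x) * w x ∂μ) (enveloping T X) := by
  have hcont : Continuous fun p : X → X => f ∘ p :=
    continuous_pi fun x => hf.comp (continuous_apply x)
  obtain ⟨M, hM⟩ := isCompact_univ.exists_bound_of_continuousOn hf.continuousOn
  refine ContinuousOn.comp (g := fun k : X → ℝ => ∫ x, k x * w x ∂μ)
    (continuousOn_integral_mul μ (K := (fun p : X → X => f ∘ p) ''
      enveloping T X) (isCompact_enveloping.image hcont) ?_ (M := M) ?_ hw) hcont.continuousOn
    (mapsTo_image _ _)
  · rintro _ ⟨p, hp, rfl⟩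
    exact hwap.continuous_comp hp hf
  · rintro _ ⟨p, hp, rfl⟩ x
    exact hM (p x) (mem_univ _)

theorem IsWeaklyAlmostPeriodic.integral_comp [ContinuousConstSMul T X]
    (hwap : IsWeaklyAlmostPeriodic T X)
    (hinv : ∀ (t : T) (f : X → ℝ), Continuous f → ∫ x, f (t • x) ∂μ = ∫ x, f x ∂μ)
    {p : X → X} (hp : p ∈ enveloping T X) {f : X → ℝ} (hf : Continuous f) :
    ∫ x, f (p x) ∂μ = ∫ x, f x ∂μ := by
  have hc := hwap.continuousOn_integral_comp_mul (μ := μ) hf continuous_one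
  simp only [Pi.one_apply, mul_one] at hc
  have := (hc.mono subset_rfl).image_closure
  have hmem := this (mem_image_of_mem _ hp)
  have himg : (fun p : X → X => ∫ x, f (p x) ∂μ) '' (range fun (t : T) (x : X) => t • x) ⊆
      {∫ x, f x ∂μ} := by
    rintro _ ⟨_, ⟨t, rfl⟩, rfl⟩
    exact hinv t f hf
  exact closure_minimal himg isClosed_singleton hmem

variable [MulAction.IsMinimal T X]

/-- A function vanishing on the closed set `range p` but not at `y` would have integral zero,
against full support. -/
theorem IsWeaklyAlmostPeriodic.surjective [ContinuousConstSMul T X]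
    (hwap : IsWeaklyAlmostPeriodic T X)
    (hinv : ∀ (t : T) (f : X → ℝ), Continuous f → ∫ x, f (t • x) ∂μ = ∫ x, f x ∂μ)
    {p : X → X} (hp : p ∈ enveloping T X) : Function.Surjective p := by
  intro y
  by_contra hy
  have hcl : IsClosed (range p) := (isCompact_range (hwap.continuous hp)).isClosed
  obtain ⟨f, hf, hf0, hf1⟩ := CompletelyRegularSpace.completely_regular y (range p) hcl hy
  have hgc : Continuous fun z => 1 - (f z : ℝ) :=
    continuous_const.sub (continuous_subtype_val.comp hf)
  have := eq_zero_of_integral_nonpos hinv hgc (fun z => sub_nonneg.2 (f z).2.2) (by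
    rw [← hwap.integral_comp hinv hp hgc]
    have : ∀ x, f (p x) = 1 := fun x => hf1 (mem_range_self x)
    simp [this]) y
  simp [hf0] at this

/-- The maps `q ∘ p` with `q ∈ E` form a compact right-topological semigroup, which contains an
idempotent; a surjective idempotent is the identity. -/
theorem IsWeaklyAlmostPeriodic.exists_leftInverse [ContinuousConstSMul T X]
    (hwap : IsWeaklyAlmostPeriodic T X)
    (hinv : ∀ (t : T) (f : X → ℝ), Continuous f → ∫ x, f (t • x) ∂μ = ∫ x, f x ∂μ)
    {p : X → X} (hp : p ∈ enveloping T X) : ∃ q ∈ enveloping T X, q ∘ p = id := by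
  let : TopologicalSpace (Function.End X) := (Pi.topologicalSpace : TopologicalSpace (X → X))
  have : T2Space (Function.End X) := (inferInstance : T2Space (X → X))
  have hright : ∀ r : X → X, Continuous fun q : X → X => q ∘ r := fun r =>
    continuous_pi fun x => continuous_apply (r x)
  obtain ⟨m, ⟨q, hq, rfl⟩, hm⟩ := exists_idempotent_in_compact_subsemigroup
    (M := Function.End X) (fun r => hright r) ((fun q : X → X => q ∘ p) '' enveloping T X)
    ⟨_, mem_image_of_mem _ hp⟩ (isCompact_enveloping.image (hright p)) (by
      rintro _ ⟨a, ha, rfl⟩ _ ⟨b, hb, rfl⟩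
      exact ⟨a ∘ p ∘ b, comp_mem_enveloping ha (comp_mem_enveloping hp hb), rfl⟩)
  refine ⟨q, hq, funext fun x => ?_⟩
  obtain ⟨y, rfl⟩ := hwap.surjective hinv (comp_mem_enveloping hq hp) x
  exact congrFun hm y

end Enveloping

/-! ### From mean-square to uniform convergence -/

/-- Near the identity, pointwise convergence in the enveloping semigroup is uniform. -/
theorem IsWeaklyAlmostPeriodic.eventually_forall_mem {T : Type u} {X : Type v} [Monoid T]
    [UniformSpace X] [CompactSpace X] [T2Space X] [Nonempty X] [MulAction T X]
    [ContinuousConstSMul T X] [MulAction.IsMinimal T X] [MeasurableSpace X] [BorelSpace X]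
    {μ : Measure X} [IsProbabilityMeasure μ] (hwap : IsWeaklyAlmostPeriodic T X)
    (hinv : ∀ (t : T) (f : X → ℝ), Continuous f → ∫ x, f (t • x) ∂μ = ∫ x, f x ∂μ)
    {ε : Set (X × X)} (hε : ε ∈ 𝓤 X) :
    ∀ᶠ p : X → X in 𝓝[enveloping T X] id, ∀ x, (x, p x) ∈ ε := by
  obtain ⟨x₀⟩ := ‹Nonempty X›
  have hint : ∀ {f : X → ℝ}, Continuous f → Integrable f μ := fun hf =>
    hf.integrable_of_compactSpace μ
  have horb : ∀ x, ∃ q ∈ enveloping T X, q x₀ = x := by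
    intro x
    have hcl : IsClosed ((fun q : X → X => q x₀) '' enveloping T X) :=
      (isCompact_enveloping.image (continuous_apply x₀)).isClosed
    have hd : Dense (range fun t : T => t • x₀) := MulAction.dense_orbit T x₀
    refine closure_minimal ?_ hcl (hd x)
    rintro _ ⟨t, rfl⟩
    exact ⟨_, smul_mem_enveloping t, rfl⟩
  choose b hb hbx using horb
  by_contra hcon
  obtain ⟨U, hUle, hUbad⟩ : ∃ U : Ultrafilter (X → X), (U : Filter (X → X)) ≤
      𝓝[enveloping T X] id ∧ ∀ᶠ p in (U : Filter (X → X)), ¬ ∀ x, (x, p x) ∈ ε := by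
    have hne := frequently_iff_neBot.1 (not_eventually.1 hcon)
    exact ⟨Ultrafilter.of _, (Ultrafilter.of_le _).trans inf_le_left,
      (Ultrafilter.of_le _).trans inf_le_right (mem_principal_self _)⟩
  -- `ξ p` will be a point that a bad `p` moves too far; `x₀` is a default value for good `p`.
  have hx : ∀ p : X → X, ∃ x, (¬ ∀ x, (x, p x) ∈ ε) → (x, p x) ∉ ε := by
    intro p
    by_cases h : ∀ x, (x, p x) ∈ ε
    · exact ⟨x₀, fun h' => absurd h h'⟩
    · push Not at h
      exact h.imp fun x hx _ => hx
  choose ξ hξ using hx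
  have hUE : ∀ᶠ p in (U : Filter (X → X)), p ∈ enveloping T X := hUle self_mem_nhdsWithin
  have lim : ∀ φ : (X → X) → X → X, (∀ᶠ p in (U : Filter (X → X)), φ p ∈ enveloping T X) →
      ∃ q ∈ enveloping T X, Tendsto φ U (𝓝[enveloping T X] q) := by
    intro φ hφ
    obtain ⟨q, hq, hqU⟩ := isCompact_enveloping.ultrafilter_le_nhds (U.map φ)
      (le_principal_iff.2 hφ)
    exact ⟨q, hq, tendsto_nhdsWithin_iff.2 ⟨hqU, hφ⟩⟩
  obtain ⟨q, hq, hqU⟩ := lim (fun p => b (ξ p)) (Eventually.of_forall fun p => hb _)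
  obtain ⟨r, hr, hrU⟩ := lim (fun p => p ∘ b (ξ p))
    (hUE.mono fun p hp => comp_mem_enveloping hp (hb _))
  have hid : id ∈ enveloping T X := by
    have := smul_mem_enveloping (T := T) (X := X) 1
    exact (funext fun x => one_smul T x : (fun x : X => (1 : T) • x) = id) ▸ this
  -- Expand the square: `p` preserves `μ`, so only the cross term varies, and it converges.
  have hL2 : ∀ f : X → ℝ, Continuous f →
      Tendsto (fun p : X → X => ∫ x, (f (p x) - f x) ^ 2 ∂μ) U (𝓝 0) := by
    intro f hf
    have h1 : Tendsto (fun p : X → X => ∫ x, f (p x) * f x ∂μ) U (𝓝 (∫ x, f x * f x ∂μ)) :=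
      (hwap.continuousOn_integral_comp_mul (μ := μ) hf hf id hid).mono_left hUle
    have h2 : Tendsto (fun p : X → X => 2 * ∫ x, f x * f x ∂μ - 2 * ∫ x, f (p x) * f x ∂μ) U
        (𝓝 0) := by
      have := (h1.const_mul 2).const_sub (2 * ∫ x, f x * f x ∂μ)
      simpa using this
    refine h2.congr' (hUE.mono fun p hp => ?_)
    have hfp : Continuous fun x => f (p x) := hwap.continuous_comp hp hf
    have hpc := hwap.continuous hp
    have h3 : ∫ x, f (p x) * f (p x) ∂μ = ∫ x, f x * f x ∂μ :=
      hwap.integral_comp hinv hp (hf.mul hf)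
    have h4 : ∀ x, (f (p x) - f x) ^ 2 = f (p x) * f (p x) - 2 * (f (p x) * f x) + f x * f x :=
      fun x => by ring
    simp only [h4]
    rw [integral_add (hint (by fun_prop)) (hint (by fun_prop)),
      integral_sub (hint (by fun_prop)) (hint (by fun_prop)), integral_const_mul, h3]
    ring
  have hrq : ∀ f : X → ℝ, Continuous f → ∀ x, f (r x) = f (q x) := by
    intro f hf x
    have hrc := hwap.continuous hr
    have hqc := hwap.continuous hq
    have hfr : Continuous fun x => f (r x) := hwap.continuous_comp hr hf
    have hfq : Continuous fun x => f (q x) := hwap.continuous_comp hq hf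
    set w : X → ℝ := fun x => f (r x) - f (q x) with hwdef
    have hw : Continuous w := hfr.sub hfq
    have hl1 : Tendsto (fun p : X → X => ∫ x, f (p (b (ξ p) x)) * w x ∂μ) U
        (𝓝 (∫ x, f (r x) * w x ∂μ)) :=
      (hwap.continuousOn_integral_comp_mul (μ := μ) hf hw r hr).tendsto.comp hrU
    have hl2 : Tendsto (fun p : X → X => ∫ x, f (b (ξ p) x) * w x ∂μ) U
        (𝓝 (∫ x, f (q x) * w x ∂μ)) :=
      (hwap.continuousOn_integral_comp_mul (μ := μ) hf hw q hq).tendsto.comp hqU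
    -- Integrate `2uw ≤ u² + w²` with `u = f ∘ p ∘ b (ξ p) - f ∘ b (ξ p)`; since `b (ξ p)` preserves
    -- `μ`, `∫ u²` tends to `0`. The limit reads `2 ∫ w² ≤ ∫ w²`, so `w = 0`.
    have hle : 2 * (∫ x, f (r x) * w x ∂μ - ∫ x, f (q x) * w x ∂μ) ≤ 0 + ∫ x, w x ^ 2 ∂μ := by
      refine le_of_tendsto_of_tendsto ((hl1.sub hl2).const_mul 2)
        ((hL2 f hf).add_const (∫ x, w x ^ 2 ∂μ)) (hUE.mono fun p hp => ?_)
      have hfp : Continuous fun x => f (p x) := hwap.continuous_comp hp hf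
      have hpc := hwap.continuous hp
      have hbc := hwap.continuous (hb (ξ p))
      have hfb : Continuous fun x => f (b (ξ p) x) := hf.comp hbc
      have hfpb : Continuous fun x => f (p (b (ξ p) x)) := hfp.comp hbc
      have h5 : ∫ x, (f (p (b (ξ p) x)) - f (b (ξ p) x)) ^ 2 ∂μ = ∫ x, (f (p x) - f x) ^ 2 ∂μ :=
        hwap.integral_comp hinv (hb (ξ p)) ((hfp.sub hf).pow 2)
      simp only
      rw [← h5, ← integral_sub (hint (by fun_prop)) (hint (by fun_prop)), ← integral_const_mul,
        ← integral_add (hint (by fun_prop)) (hint (by fun_prop))]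
      refine integral_mono (hint (by fun_prop))
        (hint (by fun_prop)) fun x => ?_
      simp only
      nlinarith [sq_nonneg (f (p (b (ξ p) x)) - f (b (ξ p) x) - w x)]
    rw [← integral_sub (hint (by fun_prop)) (hint (by fun_prop))] at hle
    have h6 : ∀ x, f (r x) * w x - f (q x) * w x = w x ^ 2 := fun x => by
      simp only [hwdef]; ring
    simp only [h6] at hle
    have := eq_zero_of_integral_nonpos hinv (f := fun x => w x ^ 2) (hw.pow 2)
      (fun x => sq_nonneg _) (by linarith) x
    exact sub_eq_zero.1 (pow_eq_zero_iff two_ne_zero |>.1 this)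
  have hrq₀ : r x₀ = q x₀ := by
    by_contra hne
    obtain ⟨f, hf, hf0, hf1⟩ := CompletelyRegularSpace.completely_regular (r x₀) {q x₀}
      isClosed_singleton (by simpa using hne)
    have := hrq (fun z => (f z : ℝ)) (continuous_subtype_val.comp hf) x₀
    simp [hf0, hf1 (mem_singleton _)] at this
  -- Evaluating at `x₀`, where `b (ξ p) x₀ = ξ p`, sends `ξ p` and `p (ξ p)` to the same limit,
  -- contradicting badness.
  have hl1 : Tendsto ξ U (𝓝 (q x₀)) := by
    have := ((continuous_apply x₀).tendsto q).comp (hqU.mono_right nhdsWithin_le_nhds)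
    simpa only [Function.comp_def, hbx] using this
  have hl2 : Tendsto (fun p : X → X => p (ξ p)) U (𝓝 (q x₀)) := by
    have := ((continuous_apply x₀).tendsto r).comp (hrU.mono_right nhdsWithin_le_nhds)
    simpa only [Function.comp_def, hbx, hrq₀] using this
  have hev : ∀ᶠ p in (U : Filter (X → X)), (ξ p, p (ξ p)) ∈ ε :=
    (hl1.prodMk_nhds hl2).eventually (nhds_le_uniformity (q x₀) hε)
  obtain ⟨p, hp, hbad⟩ := (hev.and hUbad).exists
  exact hξ p hbad hp

end Semiflow

/-! ### Syndeticity from a finite cover of the enveloping semigroup -/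

theorem mainTheorem6 {T : Type u} {X : Type v}
    [Monoid T] [TopologicalSpace T] [ContinuousMul T]
    [UniformSpace X] [CompactSpace X] [T2Space X] [Nonempty X]
    [MulAction T X] [ContinuousSMul T X]
    (hmin : MulAction.IsMinimal T X)
    (hwap : Semiflow.IsWeaklyAlmostPeriodic T X)
    (ham : Semiflow.IsAmenable T)
    (hbij : ∀ t : T, Function.Bijective (fun x : X => t • x)) :
    Semiflow.IsUniformlyAlmostPeriodic T X := by
  intro ε hε
  let : MeasurableSpace X := borel X
  have : BorelSpace X := ⟨rfl⟩
  have : Small.{u} X := Semiflow.small_of_isMinimal (T := T)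
  obtain ⟨μ, hμ, hinv⟩ := ham.exists_invariant_measure (X := X)
  obtain ⟨V, hV, hidV, hVε⟩ := mem_nhdsWithin.1 (hwap.eventually_forall_mem hinv hε)
  refine ⟨{a | ∀ x : X, (x, a • x) ∈ ε}, ?_, fun x a ha => ha x⟩
  -- A left inverse of `p` is a limit of translations, so some translation `t` already brings `t ∘
  -- p` into `V`.
  have hcover : ∀ p ∈ Semiflow.enveloping T X, ∃ t : T, (fun x => t • p x) ∈ V := by
    intro p hp
    obtain ⟨q, hq, hqp⟩ := hwap.exists_leftInverse hinv hp
    have hcont : Continuous fun r : X → X => r ∘ p := continuous_pi fun x => continuous_apply (p x)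
    obtain ⟨_, hrV, t, rfl⟩ := mem_closure_iff.1 hq _ (hV.preimage hcont)
      (show q ∘ p ∈ V from hqp ▸ hidV)
    exact ⟨t, hrV⟩
  obtain ⟨F, hF⟩ := Semiflow.isCompact_enveloping.elim_finite_subcover
    (fun t : T => {p : X → X | (fun x => t • p x) ∈ V})
    (fun t => hV.preimage (continuous_pi fun x =>
      (continuous_const_smul t).comp (continuous_apply x)))
    (fun p hp => mem_iUnion.2 (hcover p hp))
  refine ⟨F, F.finite_toSet.isCompact, fun t => ?_⟩
  obtain ⟨k, hkF, hk⟩ := mem_iUnion₂.1 (hF (Semiflow.smul_mem_enveloping t))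
  have hkt : (fun x : X => (k * t) • x) = fun x => k • t • x := funext fun x => mul_smul k t x
  refine ⟨k * t, mem_image_of_mem _ hkF, hVε ⟨?_, Semiflow.smul_mem_enveloping (k * t)⟩⟩
  change (fun x : X => (k * t) • x) ∈ V
  rw [hkt]
  exact hk
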